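/- Let $M\ge 0$ and $B\ge M+1$ be integers, and let $0\le\beta_{\min}\le 1$, $\delta\ge 0$, $\alpha\ge 0$ be real. Put $\beta(\theta)=(1-\beta_{\min})\left(\frac{\sin(\theta-\delta)+1}{2}\right)^{\alpha}+\beta_{\min}$ and $\mathcal F=\{\beta(\theta)e^{j\theta}:\theta\in[0,2\pi]\}$, and let $\mathcal S$ be the set of all $V\in\mathbb C^{(M+1)\times B}$ with $[V]_{m,n}\in\mathcal F$ for $1\le m\le M$ and $[V]_{M+1,n}=1$, for all $1\le n\le B$. Consider the problem $$\min_{V\in\mathcal S} f(V),\qquad f(V)=\operatorname{Tr}\left[(VV^H)^{-1}\right].$$ A point $W\in\mathcal S$ with $WW^H$ invertible is called stationary if the real derivative of $f$ at $W$ satisfies $Df(W)[D]\ge 0$ for every $D$ in the (Bouligand) tangent cone of $\mathcal S$ at $W$. The MM algorithm starts at some $V^{(0)}\in\mathcal S$ with $V^{(0)}(V^{(0)})^H$ invertible. Given $V_0=V^{(i)}$, let $\lambda_1=3\operatorname{Tr}[(V_0V_0^H)^{-1}]^2$, $A_0=-V_0^H(V_0V_0^H)^{-2}-\lambda_1V_0^H$,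 $\xi=(1-\beta_{\min})(1/2)^{\alpha}$ and, for $m\le M$ and $n\le B$, $$\bar f_{m,n}(\theta)=\lambda_1\left(\xi^2(\sin(\theta-\delta)+1)^{2\alpha}+\beta_{\min}^2+2\xi\beta_{\min}(\sin(\theta-\delta)+1)^{\alpha}\right)+2|[A_0]_{n,m}|\left(\xi(\sin(\theta-\delta)+1)^{\alpha}+\beta_{\min}\right)\cos(\arg([A_0]_{n,m})+\theta).$$ The next iterate $V^{(i+1)}$ has $[V^{(i+1)}]_{m,n}=\beta(\bar\theta_{m,n})e^{j\bar\theta_{m,n}}$, where $\bar\theta_{m,n}$ is any global minimizer of $\bar f_{m,n}$ over $[0,2\pi]$, for $m\le M$, and $[V^{(i+1)}]_{M+1,n}=1$. Theorem 2. From every such initial point the algorithm is well defined, and it always converges to stationary points of the problem, in the usual sense of MM (successive upper-bound minimization) algorithms. That is, every infinite sequence $(V^{(i)})$ of iterates, whatever minimizers are selected, satisfies the following. 1. Every $V^{(i)}$ lies in $\mathcal S$ with $V^{(i)}(V^{(i)})^H$ invertible; $f(V^{(i)})$ is non-increasing and converges to some $J\in\mathbb R$; and $\|V^{(i+1)}-V^{(i)}\|_F\to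 0$. 2. The sequence has at least one limit point, every limit point is a stationary point with objective value $J$, and the distance from $V^{(i)}$ to the set of stationary points with value $J$ tends to $0$. 3. If some limit point $W$ is isolated among the stationary points with value $J$, then $V^{(i)}\to W$. -/

import Mathlib

open Filter Topology
open scoped Matrix

attribute [local instance] Matrix.frobeniusNormedAddCommGroup Matrix.frobeniusNormedSpace

noncomputable section

namespace RISPattern

/-- Reflection amplitude of an RIS element as a function of its phase shift:
`β(θ) = (1 - βmin) ((sin (θ - δ) + 1) / 2) ^ α + βmin`. -/
def amplitude (βmin δ α θ : ℝ) : ℝ :=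
  (1 - βmin) * ((Real.sin (θ - δ) + 1) / 2) ^ α + βmin

/-- Reflection coefficient `β(θ) e^{jθ}`. -/
def coeff (βmin δ α θ : ℝ) : ℂ :=
  (amplitude βmin δ α θ : ℂ) * Complex.exp ((θ : ℂ) * Complex.I)

/-- The set `𝓕` of realizable reflection coefficients. -/
def coeffSet (βmin δ α : ℝ) : Set ℂ :=
  coeff βmin δ α '' Set.Icc 0 (2 * Real.pi)

/-- The constraint set: the first `M` rows have entries in `𝓕`, the last row is constant `1`. -/
def feasible (M B : ℕ) (βmin δ α : ℝ) : Set (Matrix (Fin (M + 1)) (Fin B) ℂ) :=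
  {V | (∀ (m : Fin M) (n : Fin B), V m.castSucc n ∈ coeffSet βmin δ α) ∧
    ∀ n : Fin B, V (Fin.last M) n = 1}

variable {M B : ℕ}

/-- `V Vᴴ` is invertible, i.e. the objective is defined at `V`. -/
def Regular (V : Matrix (Fin (M + 1)) (Fin B) ℂ) : Prop :=
  IsUnit (V * Vᴴ)

/-- The objective `Tr[(V Vᴴ)⁻¹]` (the trace is a real number). -/
def objective (V : Matrix (Fin (M + 1)) (Fin B) ℂ) : ℝ :=
  (Matrix.trace (V * Vᴴ)⁻¹).re

/-- `λ₁ = 3 Tr[(V₀ V₀ᴴ)⁻¹]²`. -/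
def lam (V₀ : Matrix (Fin (M + 1)) (Fin B) ℂ) : ℝ :=
  3 * objective V₀ ^ 2

/-- `A₀ = -V₀ᴴ (V₀ V₀ᴴ)⁻² - λ₁ V₀ᴴ`. -/
def matA (V₀ : Matrix (Fin (M + 1)) (Fin B) ℂ) : Matrix (Fin B) (Fin (M + 1)) ℂ :=
  -(V₀ᴴ * ((V₀ * V₀ᴴ)⁻¹) ^ 2) - (lam V₀ : ℂ) • V₀ᴴ

/-- The one-dimensional function `f̄ₘₙ` minimized over the phase shift of entry `(m, n)`, where
`ξ = (1 - βmin) (1 / 2) ^ α`. -/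
def phaseObjective (βmin δ α : ℝ) (V₀ : Matrix (Fin (M + 1)) (Fin B) ℂ)
    (m : Fin M) (n : Fin B) (θ : ℝ) : ℝ :=
  let ξ : ℝ := (1 - βmin) * (1 / 2 : ℝ) ^ α
  let a : ℂ := matA V₀ n m.castSucc
  lam V₀ * (ξ ^ 2 * (Real.sin (θ - δ) + 1) ^ (2 * α) + βmin ^ 2
      + 2 * ξ * βmin * (Real.sin (θ - δ) + 1) ^ α)
    + 2 * ‖a‖ * (ξ * (Real.sin (θ - δ) + 1) ^ α + βmin) * Real.cos (Complex.arg a + θ)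

/-- `V` is a possible result of one iteration of the algorithm from `V₀`: each entry of the first
`M` rows is `β(θ) e^{jθ}` for a global minimizer `θ` of `f̄ₘₙ` over `[0, 2π]` (any minimizer may be
selected), and the last row is constant `1`. -/
def IsUpdate (βmin δ α : ℝ) (V₀ V : Matrix (Fin (M + 1)) (Fin B) ℂ) : Prop :=
  (∀ (m : Fin M) (n : Fin B), ∃ θ ∈ Set.Icc 0 (2 * Real.pi),
      IsMinOn (phaseObjective βmin δ α V₀ m n) (Set.Icc 0 (2 * Real.pi)) θ ∧
      V m.castSucc n = coeff βmin δ α θ) ∧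
    ∀ n : Fin B, V (Fin.last M) n = 1

/-- `V 0, V 1, V 2, …` is a sequence of iterates of the algorithm with initial point `Vinit`. -/
def IsRun (βmin δ α : ℝ) (Vinit : Matrix (Fin (M + 1)) (Fin B) ℂ)
    (V : ℕ → Matrix (Fin (M + 1)) (Fin B) ℂ) : Prop :=
  V 0 = Vinit ∧ ∀ i, IsUpdate βmin δ α (V i) (V (i + 1))

/-- `W` is a stationary point of the problem of minimizing the objective over the constraint set:
`W` is feasible, the objective is defined and (real) differentiable at `W`, and its derivative is
nonnegative in every direction of the (Bouligand) tangent cone of the constraint set at `W`. -/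
def IsStationary (βmin δ α : ℝ) (W : Matrix (Fin (M + 1)) (Fin B) ℂ) : Prop :=
  W ∈ feasible M B βmin δ α ∧ Regular W ∧
    DifferentiableAt ℝ (objective (M := M) (B := B)) W ∧
    ∀ D ∈ posTangentConeAt (feasible M B βmin δ α) W,
      0 ≤ fderiv ℝ (objective (M := M) (B := B)) W D

end RISPattern

end

/-! Let `X = rightInv V₀`, so that the objective at `V₀` is `‖X‖ ^ 2` and `lam V₀ = 3 ‖X‖ ^ 4`. The
functions `phaseObjective` are, up to constants, the entrywise parts of the quadratic model `-2 Re
tr(X Xᴴ X (V - V₀)) + lam V₀ * ‖V - V₀‖ ^ 2`, whose linear term is the derivative of the objective.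
An update therefore minimizes this model over the feasible set (`IsUpdate.quadratic_model_le`).

No global upper bound is needed. The model vanishes at `V₀`, so an update makes it nonpositive,
which forces `‖V - V₀‖ * ‖X‖ ≤ 2 / 3`. Then `1 + K` is invertible for `K = (V - V₀) X`, and `X (1 +
K)⁻¹` is a right inverse of `V`. Its squared norm bounds the objective at `V`, since `rightInv` has
least norm among right inverses. The constant last row makes the decrease strict: the objective
drops by at least `B⁻² ‖V - V₀‖ ^ 2` (`sufficient_decrease`).

Hence the values converge and the steps vanish. Feasible sublevel sets are compact
(`isCompact_sublevel`), so limit points exist and are regular. By continuity each one minimizes its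
own model, whose first-order condition is stationarity (`isStationary_of_tendsto`). Vanishing steps
also prevent the sequence from leaving an isolated limit point. -/

noncomputable section

namespace RISPattern

/-! ### Frobenius inner product estimates. -/

section Frobenius

variable {m n k : Type*} [Fintype m] [Fintype n] [Fintype k]

theorem frobenius_norm_sq (A : Matrix m n ℂ) : ‖A‖ ^ 2 = ∑ i, ∑ j, ‖A i j‖ ^ 2 := by
  rw [Matrix.frobenius_norm_def, ← Real.sqrt_eq_rpow]
  simp only [Real.rpow_two]
  rw [Real.sq_sqrt (by positivity)]

theorem re_trace_conjTranspose_mul_self (A : Matrix m n ℂ) :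
    (Aᴴ * A).trace.re = ‖A‖ ^ 2 := by
  rw [frobenius_norm_sq, Finset.sum_comm]
  simp only [Matrix.trace, Matrix.diag_apply, Matrix.mul_apply, Matrix.conjTranspose_apply,
    Complex.re_sum]
  refine Finset.sum_congr rfl fun i _ => Finset.sum_congr rfl fun j _ => ?_
  rw [Complex.star_def, mul_comm, Complex.mul_conj, Complex.ofReal_re, Complex.normSq_eq_norm_sq]

theorem re_trace_conjTranspose_mul_comm (A C : Matrix m n ℂ) :
    (Aᴴ * C).trace.re = (Cᴴ * A).trace.re := by
  rw [← Complex.conj_re, ← Complex.star_def, ← Matrix.trace_conjTranspose,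
    Matrix.conjTranspose_mul, Matrix.conjTranspose_conjTranspose]

theorem frobenius_norm_add_sq (A C : Matrix m n ℂ) :
    ‖A + C‖ ^ 2 = ‖A‖ ^ 2 + 2 * (Aᴴ * C).trace.re + ‖C‖ ^ 2 := by
  simp only [← re_trace_conjTranspose_mul_self]
  rw [Matrix.conjTranspose_add, Matrix.add_mul, Matrix.mul_add, Matrix.mul_add]
  simp only [Matrix.trace_add, Complex.add_re]
  rw [re_trace_conjTranspose_mul_comm C A]
  ring

theorem abs_re_trace_conjTranspose_mul_le (A C : Matrix m n ℂ) :
    |(Aᴴ * C).trace.re| ≤ ‖A‖ * ‖C‖ := by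
  -- The polynomial is `‖A + t C‖ ^ 2` for real `t`; its discriminant gives Cauchy–Schwarz.
  have key : ∀ t : ℝ, 0 ≤ ‖C‖ ^ 2 * (t * t) + 2 * (Aᴴ * C).trace.re * t + ‖A‖ ^ 2 := by
    intro t
    have h := frobenius_norm_add_sq A ((t : ℂ) • C)
    rw [Matrix.mul_smul, Matrix.trace_smul, smul_eq_mul, Complex.re_ofReal_mul, norm_smul,
      Complex.norm_real, Real.norm_eq_abs, mul_pow, sq_abs] at h
    nlinarith [sq_nonneg ‖A + (t : ℂ) • C‖]
  have h := discrim_le_zero key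
  rw [discrim] at h
  refine abs_le_of_sq_le_sq ?_ (by positivity)
  nlinarith

/-- If the rows of `K` outside of `s` vanish, only the columns of `Z` in `s` matter in `Z * K`. -/
theorem frobenius_norm_mul_sq_le_of_row_eq_zero [DecidableEq n] (Z : Matrix m n ℂ)
    (K : Matrix n k ℂ) (j : n) (hK : K j = 0) :
    ‖Z * K‖ ^ 2 ≤ (‖Z‖ ^ 2 - ∑ i, ‖Z i j‖ ^ 2) * ‖K‖ ^ 2 := by
  have hZK : Z * K = Z.updateCol j 0 * K := by
    ext a b
    simp only [Matrix.mul_apply, Matrix.updateCol_apply]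
    refine Finset.sum_congr rfl fun c _ => ?_
    split_ifs with h
    · subst h; simp [hK]
    · rfl
  have hnorm : ‖Z.updateCol j 0‖ ^ 2 = ‖Z‖ ^ 2 - ∑ i, ‖Z i j‖ ^ 2 := by
    rw [frobenius_norm_sq, frobenius_norm_sq, ← Finset.sum_sub_distrib]
    refine Finset.sum_congr rfl fun a _ => ?_
    rw [← Finset.add_sum_erase _ _ (Finset.mem_univ j),
      ← Finset.add_sum_erase _ (fun b => ‖Z a b‖ ^ 2) (Finset.mem_univ j)]
    simp only [Matrix.updateCol_self, Pi.zero_apply, norm_zero, add_sub_cancel_left, ne_eq,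
      OfNat.ofNat_ne_zero, not_false_eq_true, zero_pow, zero_add]
    refine Finset.sum_congr rfl fun b hb => ?_
    rw [Matrix.updateCol_ne (Finset.ne_of_mem_erase hb)]
  rw [hZK, ← hnorm, ← mul_pow]
  gcongr
  exact Matrix.frobenius_norm_mul _ _

theorem isUnit_one_add_of_frobenius_norm_lt_one [DecidableEq n] (K : Matrix n n ℂ)
    (hK : ‖K‖ < 1) : IsUnit (1 + K) := by
  let : NormedRing (Matrix n n ℂ) := Matrix.frobeniusNormedRing
  have : CompleteSpace (Matrix n n ℂ) := FiniteDimensional.complete ℂ _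
  have h : IsUnit (1 - -K) := isUnit_one_sub_of_norm_lt_one (by rw [norm_neg]; exact hK)
  rwa [sub_neg_eq_add] at h

end Frobenius

/-! ### Right inverses and sufficient decrease. -/

section RightInverse

variable {M B : ℕ}

/-- The Moore–Penrose right inverse `Vᴴ (V Vᴴ)⁻¹` of a matrix of full row rank. -/
def rightInv (V : Matrix (Fin (M + 1)) (Fin B) ℂ) : Matrix (Fin B) (Fin (M + 1)) ℂ :=
  Vᴴ * (V * Vᴴ)⁻¹

theorem mul_rightInv {V : Matrix (Fin (M + 1)) (Fin B) ℂ} (hV : Regular V) :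
    V * rightInv V = 1 := by
  rw [rightInv, ← Matrix.mul_assoc]
  exact Matrix.mul_nonsing_inv _ ((Matrix.isUnit_iff_isUnit_det _).1 hV)

theorem conjTranspose_gram_inv (V : Matrix (Fin (M + 1)) (Fin B) ℂ) :
    ((V * Vᴴ)⁻¹)ᴴ = (V * Vᴴ)⁻¹ := by
  rw [Matrix.conjTranspose_nonsing_inv, Matrix.conjTranspose_mul,
    Matrix.conjTranspose_conjTranspose]

theorem conjTranspose_rightInv_mul {V : Matrix (Fin (M + 1)) (Fin B) ℂ} (hV : Regular V) :
    (rightInv V)ᴴ * rightInv V = (V * Vᴴ)⁻¹ := by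
  nth_rw 1 [rightInv]
  rw [Matrix.conjTranspose_mul, conjTranspose_gram_inv, Matrix.conjTranspose_conjTranspose,
    Matrix.mul_assoc, mul_rightInv hV, Matrix.mul_one]

theorem objective_eq_norm_rightInv_sq {V : Matrix (Fin (M + 1)) (Fin B) ℂ} (hV : Regular V) :
    objective V = ‖rightInv V‖ ^ 2 := by
  rw [objective, ← conjTranspose_rightInv_mul hV, re_trace_conjTranspose_mul_self]

theorem regular_of_mul_eq_one {V : Matrix (Fin (M + 1)) (Fin B) ℂ}
    {Z : Matrix (Fin B) (Fin (M + 1)) ℂ} (h : V * Z = 1) : Regular V := by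
  open scoped ComplexOrder in
  refine (Matrix.PosDef.mul_conjTranspose_self V fun v w hvw => ?_).isUnit
  have := congrArg (fun u => Matrix.vecMul u Z) hvw
  simpa [Matrix.vecMul_vecMul, h] using this

/-- `Z - rightInv V` is killed by `V`, hence orthogonal to `rightInv V`, whose columns lie in the
range of `Vᴴ`; Pythagoras concludes. -/
theorem objective_le_of_mul_eq_one {V : Matrix (Fin (M + 1)) (Fin B) ℂ}
    {Z : Matrix (Fin B) (Fin (M + 1)) ℂ} (h : V * Z = 1) : objective V ≤ ‖Z‖ ^ 2 := by
  have hV := regular_of_mul_eq_one h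
  rw [objective_eq_norm_rightInv_sq hV]
  have h0 : (rightInv V)ᴴ * (Z - rightInv V) = 0 := by
    rw [rightInv, Matrix.conjTranspose_mul, conjTranspose_gram_inv,
      Matrix.conjTranspose_conjTranspose, Matrix.mul_assoc, Matrix.mul_sub, h, ← rightInv,
      mul_rightInv hV, sub_self, Matrix.mul_zero]
  have h1 := frobenius_norm_add_sq (rightInv V) (Z - rightInv V)
  rw [h0, Matrix.trace_zero, Complex.zero_re, add_sub_cancel] at h1
  nlinarith [sq_nonneg ‖Z - rightInv V‖]

/-- The last column of a right inverse of a matrix with last row `1` is bounded below. -/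
theorem inv_le_sum_norm_sq_last {V : Matrix (Fin (M + 1)) (Fin B) ℂ}
    {Z : Matrix (Fin B) (Fin (M + 1)) ℂ} (h : V * Z = 1) (hV : ∀ n, V (Fin.last M) n = 1) :
    (B : ℝ)⁻¹ ≤ ∑ n, ‖Z n (Fin.last M)‖ ^ 2 := by
  have h1 : ∑ n, Z n (Fin.last M) = 1 := by
    have := congrFun (congrFun h (Fin.last M)) (Fin.last M)
    simpa [Matrix.mul_apply, hV] using this
  have hB : (0 : ℝ) < B := by
    rcases Nat.eq_zero_or_pos B with rfl | hB
    · simp at h1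
    · exact_mod_cast hB
  have h2 : (1 : ℝ) ≤ ∑ n, ‖Z n (Fin.last M)‖ := by
    calc (1 : ℝ) = ‖∑ n, Z n (Fin.last M)‖ := by rw [h1, norm_one]
      _ ≤ _ := norm_sum_le _ _
  -- The last column sums to `1`, so Cauchy–Schwarz over its `B` entries gives the bound.
  have h3 := sq_sum_le_card_mul_sum_sq (s := Finset.univ) (f := fun n => ‖Z n (Fin.last M)‖)
  rw [Finset.card_univ, Fintype.card_fin] at h3
  rw [inv_le_iff_one_le_mul₀ hB]
  nlinarith

theorem inv_le_norm_sq_of_mul_eq_one {V : Matrix (Fin (M + 1)) (Fin B) ℂ}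
    {Z : Matrix (Fin B) (Fin (M + 1)) ℂ} (h : V * Z = 1) (hV : ∀ n, V (Fin.last M) n = 1) :
    (B : ℝ)⁻¹ ≤ ‖Z‖ ^ 2 := by
  refine (inv_le_sum_norm_sq_last h hV).trans ?_
  rw [frobenius_norm_sq]
  exact Finset.sum_le_sum fun n _ =>
    Finset.single_le_sum (f := fun j => ‖Z n j‖ ^ 2) (fun _ _ => by positivity) (Finset.mem_univ _)

/-- The scalar inequality behind the sufficient decrease of the objective. -/
theorem sub_mul_le_of_quadratic_model {s z e η a b c : ℝ} (hs0 : 0 ≤ s) (hz0 : 0 ≤ z) (he0 : 0 ≤ e)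
    (hη0 : 0 ≤ η) (hη : η ≤ s ^ 2) (hes : e * s ≤ 2 / 3)
    (ha : 3 * (s ^ 2) ^ 2 * e ^ 2 ≤ 2 * a) (hb : b ≤ s * (z * (e * s) ^ 2))
    (hc : c ≤ (z ^ 2 - η) * (e * s) ^ 2) (hz : z ^ 2 = s ^ 2 - 2 * a + 2 * b + c) :
    z ^ 2 ≤ s ^ 2 - η ^ 2 * e ^ 2 := by
  -- Insert the bounds on `a`, `b`, `c` into `hz`. Apart from `η`, the bracket factors as `(s - z)
  -- (3 s + z)`.
  have hgap : (e * s) ^ 2 * (3 * s ^ 2 - 2 * s * z - z ^ 2 + η) ≤ s ^ 2 - z ^ 2 := by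
    nlinarith
  have hd : (e * s) ^ 2 ≤ 4 / 9 := by
    have : 0 ≤ e * s := by positivity
    nlinarith
  have hzs : z ≤ s := by
    -- If `z > s`, cancelling `z - s` leaves `s + z ≤ 4 / 9 * (3 s + z)`, which forces `z ≤ 3 / 5 *
    -- s`.
    by_contra! hlt
    have h1 : (e * s) ^ 2 * (3 * s ^ 2 - 2 * s * z - z ^ 2) ≤ s ^ 2 - z ^ 2 := by
      have : 0 ≤ (e * s) ^ 2 * η := by positivity
      linarith
    have h2 : (z - s) * (s + z) ≤ (z - s) * ((e * s) ^ 2 * (3 * s + z)) := by linarith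
    have h3 := le_of_mul_le_mul_left h2 (by linarith)
    have h4 : (e * s) ^ 2 * (3 * s + z) ≤ 4 / 9 * (3 * s + z) := by gcongr
    linarith
  have h5 : (e * s) ^ 2 * η ≤ s ^ 2 - z ^ 2 := by
    have h6 : 0 ≤ (e * s) ^ 2 * (3 * s ^ 2 - 2 * s * z - z ^ 2) := by
      refine mul_nonneg (by positivity) ?_
      nlinarith
    linarith
  have h7 : η ^ 2 * e ^ 2 ≤ (e * s) ^ 2 * η := by
    have : 0 ≤ e ^ 2 * η := by positivity
    nlinarith
  linarith

/-- With `K = (V - V₀) X` and `Z = X (1 + K)⁻¹`, which is a right inverse of `V`: a step that does not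
increase the quadratic model with curvature `3 ‖X‖⁴` decreases the squared norm of the right inverse
by a fixed multiple of the squared step length. -/
theorem exists_rightInverse_of_quadratic_model {V₀ V : Matrix (Fin (M + 1)) (Fin B) ℂ}
    {X : Matrix (Fin B) (Fin (M + 1)) ℂ} (hVX : V₀ * X = 1)
    (hlast₀ : ∀ n, V₀ (Fin.last M) n = 1) (hlast : ∀ n, V (Fin.last M) n = 1)
    (hstep : 3 * (‖X‖ ^ 2) ^ 2 * ‖V - V₀‖ ^ 2 ≤ 2 * (X * Xᴴ * X * (V - V₀)).trace.re) :
    ∃ Z : Matrix (Fin B) (Fin (M + 1)) ℂ, V * Z = 1 ∧ ‖Z‖ ^ 2 ≤ ‖X‖ ^ 2 - (B : ℝ)⁻¹ ^ 2 * ‖V - V₀‖ ^ 2 := by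
  obtain ⟨K, hKdef⟩ : ∃ K, K = (V - V₀) * X := ⟨_, rfl⟩
  have hη := inv_le_norm_sq_of_mul_eq_one hVX hlast₀
  have hK : ‖K‖ ≤ ‖V - V₀‖ * ‖X‖ := hKdef ▸ Matrix.frobenius_norm_mul _ _
  have hlin : (X * Xᴴ * X * (V - V₀)).trace.re = (Xᴴ * (X * K)).trace.re := by
    rw [hKdef, Matrix.mul_assoc X Xᴴ X, Matrix.mul_assoc, Matrix.trace_mul_comm]
    simp only [Matrix.mul_assoc]
  rw [hlin] at hstep
  have hVK : V * X = 1 + K := by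
    rw [hKdef, Matrix.sub_mul, hVX]; abel
  -- Both last rows equal `1`, so the step has zero last row. This is what gains the term `B⁻¹` in
  -- `hZK`.
  have hKlast : K (Fin.last M) = 0 := by
    ext j
    simp [hKdef, Matrix.mul_apply, hlast, hlast₀]
  clear hKdef hlin
  have hXK : (Xᴴ * (X * K)).trace.re ≤ ‖X‖ * (‖X‖ * ‖K‖) := by
    refine (le_abs_self _).trans ((abs_re_trace_conjTranspose_mul_le _ _).trans ?_)
    exact mul_le_mul_of_nonneg_left (Matrix.frobenius_norm_mul _ _) (norm_nonneg _)
  have hB : (0 : ℝ) ≤ (B : ℝ)⁻¹ := by positivity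
  -- With `s = ‖X‖` and `e = ‖V - V₀‖`, the hypothesis reads `3 s⁴ e² ≤ 2 a`, while `a ≤ s³ e`;
  -- divide by `s³ e` unless it vanishes.
  have hes : ‖V - V₀‖ * ‖X‖ ≤ 2 / 3 := by
    have hs0 := norm_nonneg X
    have he0 := norm_nonneg (V - V₀)
    generalize (Xᴴ * (X * K)).trace.re = a at *
    generalize ‖V - V₀‖ = e at *
    generalize ‖X‖ = s at *
    rcases (mul_nonneg he0 hs0).eq_or_lt with h | h
    · rw [← h]; norm_num
    · have hs : 0 < s := pos_of_mul_pos_right h he0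
      have he : 0 < e := pos_of_mul_pos_left h hs0
      have h0 : a ≤ s * (s * (e * s)) :=
        hXK.trans (by gcongr)
      have h1 : (3 * (e * s)) * (s ^ 3 * e) ≤ 2 * (s ^ 3 * e) := by nlinarith
      have := le_of_mul_le_mul_right h1 (by positivity)
      linarith
  have hunit := isUnit_one_add_of_frobenius_norm_lt_one K (by linarith)
  have hdet := (Matrix.isUnit_iff_isUnit_det _).1 hunit
  obtain ⟨Z, hZ⟩ : ∃ Z, Z = X * (1 + K)⁻¹ := ⟨_, rfl⟩
  have hVZ : V * Z = 1 := by
    rw [hZ, ← Matrix.mul_assoc, hVK, Matrix.mul_nonsing_inv _ hdet]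
  have hZX : Z + Z * K = X := by
    calc Z + Z * K = X * ((1 + K)⁻¹ * (1 + K)) := by
          rw [hZ, Matrix.mul_add, Matrix.mul_add, Matrix.mul_one, Matrix.mul_assoc]
      _ = X := by rw [Matrix.nonsing_inv_mul _ hdet, Matrix.mul_one]
  refine ⟨Z, hVZ, ?_⟩
  clear hZ
  have hηz := inv_le_sum_norm_sq_last hVZ hlast
  have hηz' : (B : ℝ)⁻¹ ≤ ‖Z‖ ^ 2 := inv_le_norm_sq_of_mul_eq_one hVZ hlast
  have hK2 : ‖K‖ ^ 2 ≤ (‖V - V₀‖ * ‖X‖) ^ 2 := pow_le_pow_left₀ (norm_nonneg _) hK 2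
  have hZK : ‖Z * K‖ ^ 2 ≤ (‖Z‖ ^ 2 - (B : ℝ)⁻¹) * (‖V - V₀‖ * ‖X‖) ^ 2 :=
    (frobenius_norm_mul_sq_le_of_row_eq_zero Z K _ hKlast).trans
      (mul_le_mul (by linarith) hK2 (sq_nonneg _) (by linarith))
  have hXZKK : (Xᴴ * (Z * K * K)).trace.re ≤ ‖X‖ * (‖Z‖ * (‖V - V₀‖ * ‖X‖) ^ 2) := by
    refine (le_abs_self _).trans ((abs_re_trace_conjTranspose_mul_le _ _).trans ?_)
    refine mul_le_mul_of_nonneg_left ?_ (norm_nonneg _)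
    refine le_trans ?_ (mul_le_mul_of_nonneg_left hK2 (norm_nonneg _))
    calc ‖Z * K * K‖ ≤ ‖Z * K‖ * ‖K‖ := Matrix.frobenius_norm_mul _ _
      _ ≤ (‖Z‖ * ‖K‖) * ‖K‖ :=
        mul_le_mul_of_nonneg_right (Matrix.frobenius_norm_mul _ _) (norm_nonneg _)
      _ = ‖Z‖ * ‖K‖ ^ 2 := by ring
  -- Expand the square of `Z = X - Z K`, then substitute for `Z` once more in the cross term.
  have hident : ‖Z‖ ^ 2 = ‖X‖ ^ 2 - 2 * (Xᴴ * (X * K)).trace.re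
      + 2 * (Xᴴ * (Z * K * K)).trace.re + ‖Z * K‖ ^ 2 := by
    have h1 := frobenius_norm_add_sq X (-(Z * K))
    have h2 : X + -(Z * K) = Z := by rw [← hZX]; abel
    have h3 : Xᴴ * (Z * K) = Xᴴ * (X * K) - Xᴴ * (Z * K * K) := by
      rw [← Matrix.mul_sub, ← Matrix.sub_mul]
      congr 2
      rw [← hZX]; abel
    rw [h2, Matrix.mul_neg, Matrix.trace_neg, h3, Matrix.trace_sub, norm_neg] at h1
    simp only [Complex.neg_re, Complex.sub_re] at h1
    linarith
  exact sub_mul_le_of_quadratic_model (norm_nonneg _) (norm_nonneg _) (norm_nonneg _) hB hη hes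
    hstep hXZKK hZK hident

theorem sufficient_decrease {V₀ V : Matrix (Fin (M + 1)) (Fin B) ℂ} (h₀ : Regular V₀)
    (hlast₀ : ∀ n, V₀ (Fin.last M) n = 1) (hlast : ∀ n, V (Fin.last M) n = 1)
    (hstep : lam V₀ * ‖V - V₀‖ ^ 2 ≤
      2 * (rightInv V₀ * (rightInv V₀)ᴴ * rightInv V₀ * (V - V₀)).trace.re) :
    Regular V ∧ objective V ≤ objective V₀ - (B : ℝ)⁻¹ ^ 2 * ‖V - V₀‖ ^ 2 := by
  rw [lam, objective_eq_norm_rightInv_sq h₀] at hstep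
  obtain ⟨Z, hVZ, hZ⟩ :=
    exists_rightInverse_of_quadratic_model (mul_rightInv h₀) hlast₀ hlast hstep
  refine ⟨regular_of_mul_eq_one hVZ, (objective_le_of_mul_eq_one hVZ).trans ?_⟩
  rwa [objective_eq_norm_rightInv_sq h₀]

end RightInverse

end RISPattern

end

noncomputable section

namespace RISPattern

/-! ### Derivative of the objective and the first-order condition. -/

section Derivative

theorem hasFDerivAt_ringInverse_quadratic {E R : Type*} [NormedAddCommGroup E] [NormedSpace ℝ E]
    [FiniteDimensional ℝ E] [NormedRing R] [NormedAlgebra ℝ R] [FiniteDimensional ℝ R]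
    (b : E →ₗ[ℝ] E →ₗ[ℝ] R) (l : R →ₗ[ℝ] ℝ) (x : E) (hx : IsUnit (b x x)) :
    ∃ f' : E →L[ℝ] ℝ, HasFDerivAt (fun v => l (Ring.inverse (b v v))) f' x ∧
      ∀ h, f' h = -l (Ring.inverse (b x x) * (b x h + b h x) * Ring.inverse (b x x)) := by
  have : CompleteSpace R := FiniteDimensional.complete ℝ R
  obtain ⟨u, hu⟩ := hx
  have h1 : HasFDerivAt (fun v => b v v) _ x :=
    ContinuousLinearMap.hasFDerivAt_of_bilinear b.toContinuousBilinearMap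
      (hasFDerivAt_id x) (hasFDerivAt_id x)
  have h2 : HasFDerivAt Ring.inverse _ (b x x) := hu ▸ hasFDerivAt_ringInverse (𝕜 := ℝ) u
  have h3 := (LinearMap.toContinuousLinearMap l).hasFDerivAt (x := Ring.inverse (b x x))
  refine ⟨_, h3.comp x (HasFDerivAt.comp (f := fun v => b v v) x h2 h1), fun h => ?_⟩
  simp [← hu, mul_add, add_mul, add_comm]

/-- The quadratic term has zero derivative at `x`, so `f'` is the derivative at `x` of a function
minimized there over `s`. -/
theorem nonneg_of_mem_posTangentConeAt {E : Type*} [NormedAddCommGroup E] [NormedSpace ℝ E]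
    {s : Set E} {x : E} (f' : E →L[ℝ] ℝ) (c : ℝ)
    (h : ∀ y ∈ s, 0 ≤ f' (y - x) + c * ‖y - x‖ ^ 2) {y : E} (hy : y ∈ posTangentConeAt s x) :
    0 ≤ f' y := by
  have h1 : HasFDerivAt (fun y => c * ‖y - x‖ ^ 2) (0 : E →L[ℝ] ℝ) x := by
    refine Asymptotics.IsBigO.hasFDerivAt (n := 2) ?_ one_lt_two
    exact Asymptotics.isBigO_const_mul_self c _ _
  have h2 : HasFDerivAt (fun y => f' (y - x) + c * ‖y - x‖ ^ 2) f' x := by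
    have h3 : HasFDerivAt (fun y => f' (y - x)) f' x :=
      f'.hasFDerivAt.comp x ((hasFDerivAt_id x).sub_const x)
    simpa only [add_zero] using h3.fun_add h1
  refine IsLocalMinOn.hasFDerivWithinAt_nonneg (s := s) (a := x) ?_ h2.hasFDerivWithinAt hy
  refine IsMinOn.localize fun z hz => ?_
  simpa using h z hz

variable {M B : ℕ}

theorem hasFDerivAt_objective {W : Matrix (Fin (M + 1)) (Fin B) ℂ} (hW : Regular W) :
    ∃ f' : Matrix (Fin (M + 1)) (Fin B) ℂ →L[ℝ] ℝ, HasFDerivAt objective f' W ∧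
      ∀ D, f' D = -2 * (rightInv W * (rightInv W)ᴴ * rightInv W * D).trace.re := by
  let _ : NormedRing (Matrix (Fin (M + 1)) (Fin (M + 1)) ℂ) := Matrix.frobeniusNormedRing
  let _ : NormedAlgebra ℝ (Matrix (Fin (M + 1)) (Fin (M + 1)) ℂ) := Matrix.frobeniusNormedAlgebra
  let b : Matrix (Fin (M + 1)) (Fin B) ℂ →ₗ[ℝ] Matrix (Fin (M + 1)) (Fin B) ℂ →ₗ[ℝ]
      Matrix (Fin (M + 1)) (Fin (M + 1)) ℂ :=
    LinearMap.mk₂ ℝ (fun V U => V * Uᴴ)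
      (fun _ _ _ => Matrix.add_mul _ _ _) (fun _ _ _ => Matrix.smul_mul _ _ _)
      (fun _ _ _ => by rw [Matrix.conjTranspose_add, Matrix.mul_add])
      (fun _ _ _ => by
        rw [Matrix.conjTranspose_smul, Matrix.mul_smul, star_trivial])
  let l : Matrix (Fin (M + 1)) (Fin (M + 1)) ℂ →ₗ[ℝ] ℝ :=
    Complex.reLm ∘ₗ Matrix.traceLinearMap (Fin (M + 1)) ℝ ℂ
  obtain ⟨f', h1, h2⟩ := hasFDerivAt_ringInverse_quadratic b l W hW
  have hobj : (fun V => l (Ring.inverse (b V V))) = objective := by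
    funext V
    rw [← Matrix.nonsing_inv_eq_ringInverse]
    rfl
  rw [hobj] at h1
  refine ⟨f', h1, fun D => (h2 D).trans ?_⟩
  rw [← Matrix.nonsing_inv_eq_ringInverse]
  change -((W * Wᴴ)⁻¹ * (W * Dᴴ + D * Wᴴ) * (W * Wᴴ)⁻¹).trace.re = _
  -- The derivative is a matrix plus its adjoint, so the real trace doubles; hence the factor `2`.
  have e1 : (W * Wᴴ)⁻¹ * (W * Dᴴ + D * Wᴴ) * (W * Wᴴ)⁻¹ =
      ((W * Wᴴ)⁻¹ * D * rightInv W)ᴴ + (W * Wᴴ)⁻¹ * D * rightInv W := by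
    simp only [rightInv, Matrix.conjTranspose_mul, conjTranspose_gram_inv,
      Matrix.conjTranspose_conjTranspose, Matrix.mul_add, Matrix.add_mul, Matrix.mul_assoc]
  have e2 : (rightInv W * (rightInv W)ᴴ * rightInv W * D).trace =
      ((W * Wᴴ)⁻¹ * D * rightInv W).trace := by
    rw [Matrix.mul_assoc (rightInv W), conjTranspose_rightInv_mul hW, Matrix.mul_assoc,
      Matrix.trace_mul_comm]
  rw [e1, e2, Matrix.trace_add, Matrix.trace_conjTranspose, Complex.add_re, Complex.star_def,
    Complex.conj_re]
  ring

/-- A feasible point that minimizes the quadratic model of the objective around itself is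
stationary. -/
theorem isStationary_of_quadratic_model {βmin δ α c : ℝ} {W : Matrix (Fin (M + 1)) (Fin B) ℂ}
    (hfeas : W ∈ feasible M B βmin δ α) (hW : Regular W)
    (hmin : ∀ U ∈ feasible M B βmin δ α,
      0 ≤ c * ‖U - W‖ ^ 2 -
        2 * (rightInv W * (rightInv W)ᴴ * rightInv W * (U - W)).trace.re) :
    IsStationary βmin δ α W := by
  obtain ⟨f', h1, h2⟩ := hasFDerivAt_objective hW
  refine ⟨hfeas, hW, h1.differentiableAt, fun D hD => ?_⟩
  have hf' : fderiv ℝ objective W = f' := h1.fderiv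
  rw [hf']
  refine nonneg_of_mem_posTangentConeAt (s := feasible M B βmin δ α) (x := W) f' c
    (fun U hU => ?_) hD
  have := hmin U hU
  have h3 := h2 (U - W)
  change 0 ≤ f' (U - W) + _
  rw [h3]
  linarith

end Derivative

end RISPattern

end

noncomputable section

namespace RISPattern

/-! ### Reflection coefficients and the separable model. -/

section Amplitude

variable {βmin δ α : ℝ}

theorem sin_add_one_nonneg (x : ℝ) : 0 ≤ Real.sin x + 1 := by
  linarith [Real.neg_one_le_sin x]

theorem amplitude_eq (βmin δ α θ : ℝ) :
    amplitude βmin δ α θ =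
      (1 - βmin) * (1 / 2 : ℝ) ^ α * (Real.sin (θ - δ) + 1) ^ α + βmin := by
  rw [amplitude, div_eq_mul_one_div, Real.mul_rpow (sin_add_one_nonneg _) (by norm_num)]
  ring

theorem continuous_amplitude (hα : 0 ≤ α) : Continuous (amplitude βmin δ α) := by
  unfold amplitude
  have : Continuous fun θ : ℝ => ((Real.sin (θ - δ) + 1) / 2) ^ α :=
    Continuous.rpow_const (by fun_prop) fun _ => Or.inr hα
  fun_prop

theorem continuous_coeff (hα : 0 ≤ α) : Continuous (coeff βmin δ α) := by
  have := continuous_amplitude (βmin := βmin) (δ := δ) hα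
  unfold coeff
  fun_prop

theorem isCompact_coeffSet (hα : 0 ≤ α) : IsCompact (coeffSet βmin δ α) :=
  isCompact_Icc.image (continuous_coeff hα)

theorem norm_coeff_sq (θ : ℝ) : ‖coeff βmin δ α θ‖ ^ 2 = amplitude βmin δ α θ ^ 2 := by
  rw [coeff, norm_mul, Complex.norm_exp_ofReal_mul_I, mul_one, Complex.norm_real,
    Real.norm_eq_abs, sq_abs]

theorem re_mul_coeff (a : ℂ) (θ : ℝ) :
    (a * coeff βmin δ α θ).re = ‖a‖ * amplitude βmin δ α θ * Real.cos (a.arg + θ) := by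
  have h : a * coeff βmin δ α θ = ((‖a‖ * amplitude βmin δ α θ : ℝ) : ℂ) *
      Complex.exp (((a.arg + θ : ℝ) : ℂ) * Complex.I) := by
    nth_rw 1 [← Complex.norm_mul_exp_arg_mul_I a]
    rw [coeff, Complex.ofReal_add, add_mul, Complex.exp_add, Complex.ofReal_mul]
    ring
  rw [h, Complex.re_ofReal_mul, Complex.exp_ofReal_mul_I_re]

variable {M B : ℕ}

theorem phaseObjective_eq (V₀ : Matrix (Fin (M + 1)) (Fin B) ℂ) (m : Fin M) (n : Fin B) (θ : ℝ) :
    phaseObjective βmin δ α V₀ m n θ = lam V₀ * ‖coeff βmin δ α θ‖ ^ 2 +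
      2 * (matA V₀ n m.castSucc * coeff βmin δ α θ).re := by
  have h2 : (Real.sin (θ - δ) + 1) ^ (2 * α) = ((Real.sin (θ - δ) + 1) ^ α) ^ 2 := by
    rw [mul_comm, ← Real.rpow_mul_natCast (sin_add_one_nonneg _)]
    norm_num
  rw [norm_coeff_sq, re_mul_coeff, amplitude_eq, phaseObjective, h2]
  ring

theorem continuous_phaseObjective (hα : 0 ≤ α) (V₀ : Matrix (Fin (M + 1)) (Fin B) ℂ) (m : Fin M)
    (n : Fin B) : Continuous (phaseObjective βmin δ α V₀ m n) := by
  have h := continuous_coeff (βmin := βmin) (δ := δ) hα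
  rw [funext (phaseObjective_eq (βmin := βmin) (δ := δ) (α := α) V₀ m n)]
  exact (continuous_const.mul (h.norm.pow 2)).add
    (continuous_const.mul (Complex.continuous_re.comp (continuous_const.mul h)))

theorem exists_isUpdate (hα : 0 ≤ α) (V₀ : Matrix (Fin (M + 1)) (Fin B) ℂ) :
    ∃ V, IsUpdate βmin δ α V₀ V := by
  have h : ∀ (m : Fin M) (n : Fin B), ∃ θ ∈ Set.Icc 0 (2 * Real.pi),
      IsMinOn (phaseObjective βmin δ α V₀ m n) (Set.Icc 0 (2 * Real.pi)) θ := fun m n =>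
    isCompact_Icc.exists_isMinOn (Set.nonempty_Icc.2 (by positivity))
      (continuous_phaseObjective hα V₀ m n).continuousOn
  choose θ hθ hmin using h
  refine ⟨fun i n => Fin.lastCases (motive := fun _ => ℂ) 1
    (fun m => coeff βmin δ α (θ m n)) i, fun m n => ⟨θ m n, hθ m n, hmin m n, ?_⟩, fun n => ?_⟩
  · simp
  · simp

theorem IsUpdate.mem_feasible {V₀ V : Matrix (Fin (M + 1)) (Fin B) ℂ}
    (h : IsUpdate βmin δ α V₀ V) : V ∈ feasible M B βmin δ α :=
  ⟨fun m n => by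
    obtain ⟨θ, hθ, -, hV⟩ := h.1 m n
    exact ⟨θ, hθ, hV.symm⟩, h.2⟩

theorem isCompact_feasible (hα : 0 ≤ α) : IsCompact (feasible M B βmin δ α) := by
  have h : feasible M B βmin δ α = Set.pi Set.univ fun i : Fin (M + 1) =>
      Set.pi Set.univ fun _ : Fin B =>
        Fin.lastCases (motive := fun _ => Set ℂ) {1} (fun _ => coeffSet βmin δ α) i := by
    ext V
    change (_ ∧ _) ↔ ∀ i ∈ Set.univ, ∀ n ∈ Set.univ, V i n ∈ _
    simp only [Set.mem_univ, forall_const, Fin.forall_fin_succ', Fin.lastCases_castSucc,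
      Fin.lastCases_last, Set.mem_singleton_iff]
  rw [h]
  refine isCompact_univ_pi fun i => isCompact_univ_pi fun _ => ?_
  refine Fin.lastCases ?_ (fun _ => ?_) i
  · simp
  · simpa using isCompact_coeffSet hα

theorem matA_eq {V₀ : Matrix (Fin (M + 1)) (Fin B) ℂ} (h₀ : Regular V₀) :
    matA V₀ = -(rightInv V₀ * (rightInv V₀)ᴴ * rightInv V₀) - (lam V₀ : ℂ) • V₀ᴴ := by
  rw [matA, Matrix.mul_assoc (rightInv V₀), conjTranspose_rightInv_mul h₀, rightInv, pow_two,
    Matrix.mul_assoc]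

/-- Expanding `‖V - V₀‖ ^ 2` moves its cross term into `matA`; what remains is separable in the
entries of `V`, up to a constant independent of `V`. -/
theorem quadratic_model_eq_sum {V₀ : Matrix (Fin (M + 1)) (Fin B) ℂ} (h₀ : Regular V₀)
    (V : Matrix (Fin (M + 1)) (Fin B) ℂ) :
    lam V₀ * ‖V - V₀‖ ^ 2 -
      2 * (rightInv V₀ * (rightInv V₀)ᴴ * rightInv V₀ * (V - V₀)).trace.re =
    ∑ i, ∑ n, (lam V₀ * ‖V i n‖ ^ 2 + 2 * (matA V₀ n i * V i n).re) +
      (lam V₀ * ‖V₀‖ ^ 2 +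
        2 * (rightInv V₀ * (rightInv V₀)ᴴ * rightInv V₀ * V₀).trace.re) := by
  have h1 : ∑ i, ∑ n, (lam V₀ * ‖V i n‖ ^ 2 + 2 * (matA V₀ n i * V i n).re) =
      lam V₀ * ‖V‖ ^ 2 + 2 * (matA V₀ * V).trace.re := by
    simp only [Finset.sum_add_distrib, ← Finset.mul_sum, frobenius_norm_sq, Matrix.trace,
      Matrix.diag_apply, Matrix.mul_apply, Complex.re_sum]
    rw [Finset.sum_comm (f := fun i n => (matA V₀ n i * V i n).re)]
  have h2 := frobenius_norm_add_sq V₀ (V - V₀)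
  have h3 : (matA V₀ * V).trace.re =
      -(rightInv V₀ * (rightInv V₀)ᴴ * rightInv V₀ * V).trace.re
        - lam V₀ * (V₀ᴴ * V).trace.re := by
    rw [matA_eq h₀, Matrix.sub_mul, Matrix.neg_mul, Matrix.smul_mul, Matrix.trace_sub,
      Matrix.trace_neg, Matrix.trace_smul, smul_eq_mul, Complex.sub_re, Complex.neg_re,
      Complex.re_ofReal_mul]
  rw [add_sub_cancel, Matrix.mul_sub, Matrix.trace_sub, Complex.sub_re,
    re_trace_conjTranspose_mul_self] at h2
  rw [h1, h3, Matrix.mul_sub, Matrix.trace_sub, Complex.sub_re]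
  linear_combination (-lam V₀) * h2

theorem IsUpdate.quadratic_model_le {V₀ V U : Matrix (Fin (M + 1)) (Fin B) ℂ} (h₀ : Regular V₀)
    (h : IsUpdate βmin δ α V₀ V) (hU : U ∈ feasible M B βmin δ α) :
    lam V₀ * ‖V - V₀‖ ^ 2 -
      2 * (rightInv V₀ * (rightInv V₀)ᴴ * rightInv V₀ * (V - V₀)).trace.re ≤
    lam V₀ * ‖U - V₀‖ ^ 2 -
      2 * (rightInv V₀ * (rightInv V₀)ᴴ * rightInv V₀ * (U - V₀)).trace.re := by
  rw [quadratic_model_eq_sum h₀, quadratic_model_eq_sum h₀]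
  refine add_le_add_left (Finset.sum_le_sum fun i _ => Finset.sum_le_sum fun n _ => ?_) _
  refine Fin.lastCases ?_ (fun m => ?_) i
  · rw [h.2, hU.2]
  · obtain ⟨θ, -, hmin, hV⟩ := h.1 m n
    obtain ⟨φ, hφ, hUφ⟩ := hU.1 m n
    rw [hV, ← hUφ, ← phaseObjective_eq, ← phaseObjective_eq]
    exact hmin hφ

theorem IsUpdate.sufficient_decrease {V₀ V : Matrix (Fin (M + 1)) (Fin B) ℂ} (h₀ : Regular V₀)
    (hfeas : V₀ ∈ feasible M B βmin δ α) (h : IsUpdate βmin δ α V₀ V) :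
    Regular V ∧ objective V ≤ objective V₀ - (B : ℝ)⁻¹ ^ 2 * ‖V - V₀‖ ^ 2 := by
  refine RISPattern.sufficient_decrease h₀ hfeas.2 h.2 ?_
  -- Compare with `U = V₀`, where the model is `0`.
  have := h.quadratic_model_le h₀ hfeas
  simp only [sub_self, norm_zero, Matrix.mul_zero, Matrix.trace_zero, Complex.zero_re] at this
  linarith

end Amplitude

end RISPattern

end

noncomputable section

namespace RISPattern

/-! ### Cluster points of sequences in compact sets. -/

section Sequences

variable {E : Type*} [MetricSpace E] {K : Set E} {x : ℕ → E}

theorem tendsto_infDist_of_mapClusterPt_mem (hK : IsCompact K) (hx : ∀ i, x i ∈ K) {s : Set E}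
    (hs : ∀ w, MapClusterPt w atTop x → w ∈ s) :
    Tendsto (fun i => Metric.infDist (x i) s) atTop (𝓝 0) := by
  refine tendsto_of_subseq_tendsto fun ns hns => ?_
  obtain ⟨w, -, φ, hφ, hw⟩ := hK.tendsto_subseq fun i => hx (ns i)
  have hcl : MapClusterPt w atTop x :=
    MapClusterPt.of_comp (hns.comp hφ.tendsto_atTop) hw.mapClusterPt
  refine ⟨φ, ?_⟩
  rw [← Metric.infDist_zero_of_mem (hs w hcl)]
  exact ((Metric.continuous_infDist_pt s).tendsto w).comp hw

/-- A sequence in a compact set with steps tending to zero converges to every isolated cluster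
point. -/
theorem tendsto_of_isolated_mapClusterPt (hK : IsCompact K) (hx : ∀ i, x i ∈ K)
    (hstep : Tendsto (fun i => dist (x (i + 1)) (x i)) atTop (𝓝 0)) {w : E}
    (hw : MapClusterPt w atTop x)
    (hiso : ∀ᶠ w' in 𝓝 w, MapClusterPt w' atTop x → w' = w) :
    Tendsto x atTop (𝓝 w) := by
  obtain ⟨r, hr, hball⟩ := Metric.eventually_nhds_iff.1 hiso
  rw [Metric.tendsto_atTop']
  intro ε' hε'
  obtain ⟨ε, hε, hεr, hεε'⟩ : ∃ ε > 0, ε < r ∧ ε < ε' :=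
    ⟨min r ε' / 2, by positivity, by linarith [min_le_left r ε', lt_min hr hε'],
      by linarith [min_le_right r ε', lt_min hr hε']⟩
  -- Infinitely many visits to this compact annulus would create a cluster point in it, which
  -- isolation identifies with `w` itself.
  have hannulus : ∀ᶠ i in atTop, ¬ (ε / 2 ≤ dist (x i) w ∧ dist (x i) w ≤ ε) := by
    by_contra hfr
    rw [Filter.not_eventually] at hfr
    simp only [not_not] at hfr
    have hclosed : IsClosed {y | ε / 2 ≤ dist y w ∧ dist y w ≤ ε} :=
      isClosed_Icc.preimage (continuous_id.dist continuous_const)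
    have hA := hK.inter_right hclosed
    obtain ⟨y, hy, hcl⟩ := hA.exists_mapClusterPt_of_frequently
      (hfr.mono fun i hi => ⟨hx i, hi⟩)
    have := hball (lt_of_le_of_lt hy.2.2 hεr) hcl
    rw [this] at hy
    have h := hy.2.1
    rw [dist_self] at h
    linarith
  have hsmall : ∀ᶠ i in atTop, dist (x (i + 1)) (x i) < ε / 2 :=
    hstep.eventually_lt_const (by positivity)
  obtain ⟨N, hN⟩ := Filter.eventually_atTop.1 (hannulus.and hsmall)
  have hfreq : ∃ᶠ i in atTop, dist (x i) w < ε / 2 :=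
    hw.frequently (Metric.ball_mem_nhds w (by positivity))
  obtain ⟨i₀, hi₀, hdist⟩ := Filter.frequently_atTop.1 hfreq N
  -- A step shorter than `ε / 2` from the inner ball cannot cross the forbidden annulus.
  have hstay : ∀ i ≥ i₀, dist (x i) w < ε / 2 := by
    intro i hi
    induction i, hi using Nat.le_induction with
    | base => exact hdist
    | succ i hi ih =>
      have h1 := (hN i (hi₀.trans hi)).2
      have h2 := (hN (i + 1) (hi₀.trans (hi.trans i.le_succ))).1
      have h3 := dist_triangle (x (i + 1)) (x i) w
      by_contra! h4
      exact h2 ⟨h4, by linarith⟩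
  exact ⟨i₀, fun i hi => by linarith [hstay i hi.le]⟩

end Sequences

/-! ### Compact sublevel sets and passage to the limit. -/

section Convergence

variable {M B : ℕ} {βmin δ α : ℝ}

theorem continuous_frobenius_norm {m n : Type*} [Fintype m] [Fintype n] :
    Continuous fun A : Matrix m n ℂ => ‖A‖ := by
  exact (continuous_norm : Continuous fun A : Matrix m n ℂ => ‖A‖)

theorem isCompact_frobenius_closedBall {m n : Type*} [Fintype m] [Fintype n] (r : ℝ) :
    IsCompact {A : Matrix m n ℂ | ‖A‖ ≤ r} := by
  have : ProperSpace (Matrix m n ℂ) := FiniteDimensional.proper ℂ _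
  have h := isCompact_closedBall (0 : Matrix m n ℂ) r
  simp only [Metric.closedBall, dist_zero_right] at h
  exact h

theorem continuousAt_rightInv {W : Matrix (Fin (M + 1)) (Fin B) ℂ} (hW : Regular W) :
    ContinuousAt rightInv W := by
  have hdet := (Matrix.isUnit_iff_isUnit_det _).1 hW
  have h1 : ContinuousAt (fun A : Matrix (Fin (M + 1)) (Fin (M + 1)) ℂ => A⁻¹) (W * Wᴴ) := by
    refine continuousAt_matrix_inv _ ?_
    rw [Ring.inverse_eq_inv']
    exact continuousAt_inv₀ hdet.ne_zero
  have h2 : Continuous fun V : Matrix (Fin (M + 1)) (Fin B) ℂ => V * Vᴴ := by fun_prop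
  have h3 : ContinuousAt (fun V : Matrix (Fin (M + 1)) (Fin B) ℂ => (V * Vᴴ)⁻¹) W :=
    ContinuousAt.comp (f := fun V : Matrix (Fin (M + 1)) (Fin B) ℂ => V * Vᴴ) h1 h2.continuousAt
  have h4 : Continuous fun p : Matrix (Fin (M + 1)) (Fin B) ℂ ×
      Matrix (Fin (M + 1)) (Fin (M + 1)) ℂ => p.1ᴴ * p.2 := by fun_prop
  exact ContinuousAt.comp (f := fun V : Matrix (Fin (M + 1)) (Fin B) ℂ => (V, (V * Vᴴ)⁻¹))
    h4.continuousAt (continuousAt_id.prodMk h3)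

theorem continuousAt_objective {W : Matrix (Fin (M + 1)) (Fin B) ℂ} (hW : Regular W) :
    ContinuousAt objective W := by
  obtain ⟨f', h, -⟩ := hasFDerivAt_objective hW
  exact h.continuousAt

/-- The set is the projection of the compact set of pairs `(V, Z)` with `V` feasible, `V * Z = 1`
and `‖Z‖ ≤ √c`: a bounded right inverse certifies both regularity and the bound on the objective. -/
theorem isCompact_sublevel (hα : 0 ≤ α) (c : ℝ) :
    IsCompact {V | V ∈ feasible M B βmin δ α ∧ Regular V ∧ objective V ≤ c} := by
  have hmul : IsClosed {p : Matrix (Fin (M + 1)) (Fin B) ℂ × Matrix (Fin B) (Fin (M + 1)) ℂ |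
      p.1 * p.2 = 1} := isClosed_eq (by fun_prop) continuous_const
  have h := (((isCompact_feasible (M := M) (B := B) (βmin := βmin) (δ := δ) hα).prod
    (isCompact_frobenius_closedBall (m := Fin B) (n := Fin (M + 1)) (√c))).inter_right hmul).image
      continuous_fst
  have hlevel : {V | V ∈ feasible M B βmin δ α ∧ Regular V ∧ objective V ≤ c} =
      Prod.fst '' ((feasible M B βmin δ α ×ˢ
        {A : Matrix (Fin B) (Fin (M + 1)) ℂ | ‖A‖ ≤ √c}) ∩ {p | p.1 * p.2 = 1}) := by
    ext V
    constructor
    · rintro ⟨hV, hreg, hc⟩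
      refine ⟨(V, rightInv V), ⟨⟨hV, ?_⟩, mul_rightInv hreg⟩, rfl⟩
      exact Real.le_sqrt_of_sq_le (by rwa [← objective_eq_norm_rightInv_sq hreg])
    · rintro ⟨⟨V, Z⟩, ⟨⟨hV, hZ⟩, hVZ⟩, rfl⟩
      have hVZ : V * Z = 1 := hVZ
      have hZ : ‖Z‖ ≤ √c := hZ
      refine ⟨hV, regular_of_mul_eq_one hVZ, (objective_le_of_mul_eq_one hVZ).trans ?_⟩
      rcases le_or_gt 0 c with hc | hc
      · exact (Real.le_sqrt (norm_nonneg _) hc).1 hZ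
      -- For `c < 0` the square root is `0` by convention, and `Z = 0` cannot be a right inverse.
      · rw [Real.sqrt_eq_zero_of_nonpos hc.le] at hZ
        have hZ0 : Z = 0 := norm_le_zero_iff.1 hZ
        rw [hZ0, Matrix.mul_zero] at hVZ
        exact absurd hVZ zero_ne_one
  rw [hlevel]
  exact h

theorem exists_isRun (hα : 0 ≤ α) (Vinit : Matrix (Fin (M + 1)) (Fin B) ℂ) :
    ∃ V, IsRun βmin δ α Vinit V := by
  choose next hnext using fun V₀ : Matrix (Fin (M + 1)) (Fin B) ℂ =>
    exists_isUpdate (βmin := βmin) (δ := δ) hα V₀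
  exact ⟨fun i => next^[i] Vinit, rfl, fun i => by
    simp only [Function.iterate_succ_apply']
    exact hnext _⟩

variable {Vinit : Matrix (Fin (M + 1)) (Fin B) ℂ} {V : ℕ → Matrix (Fin (M + 1)) (Fin B) ℂ}

theorem IsRun.mem_feasible_and_regular (hV : IsRun βmin δ α Vinit V)
    (hfeas : Vinit ∈ feasible M B βmin δ α) (hreg : Regular Vinit) (i : ℕ) :
    V i ∈ feasible M B βmin δ α ∧ Regular (V i) := by
  induction i with
  | zero => rw [hV.1]; exact ⟨hfeas, hreg⟩
  | succ i ih => exact ⟨(hV.2 i).mem_feasible, ((hV.2 i).sufficient_decrease ih.2 ih.1).1⟩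

theorem tendsto_zero_of_sufficient_decrease {f e : ℕ → ℝ} {c J : ℝ} (hc : 0 < c)
    (he : ∀ i, 0 ≤ e i) (h : ∀ i, f (i + 1) ≤ f i - c * e i ^ 2)
    (hf : Tendsto f atTop (𝓝 J)) : Tendsto e atTop (𝓝 0) := by
  have h1 : Tendsto (fun i => (f i - f (i + 1)) / c) atTop (𝓝 0) := by
    simpa using (hf.sub (hf.comp (tendsto_add_atTop_nat 1))).div_const c
  have h2 : Tendsto (fun i => √((f i - f (i + 1)) / c)) atTop (𝓝 0) := by
    simpa using h1.sqrt
  refine squeeze_zero he (fun i => Real.le_sqrt_of_sq_le ?_) h2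
  rw [le_div_iff₀ hc]
  linarith [h i]

/-- A regular limit of a subsequence along which the steps vanish minimizes its own quadratic
model, hence is stationary. -/
theorem isStationary_of_tendsto {U U' : ℕ → Matrix (Fin (M + 1)) (Fin B) ℂ}
    {W : Matrix (Fin (M + 1)) (Fin B) ℂ} (hfeas : W ∈ feasible M B βmin δ α) (hW : Regular W)
    (hreg : ∀ i, Regular (U i)) (hupd : ∀ i, IsUpdate βmin δ α (U i) (U' i))
    (hU : Tendsto U atTop (𝓝 W)) (hU' : Tendsto U' atTop (𝓝 W)) :
    IsStationary βmin δ α W := by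
  have hlam : Tendsto (fun i => lam (U i)) atTop (𝓝 (lam W)) :=
    (((continuousAt_objective hW).tendsto.comp hU).pow 2).const_mul 3
  have hX : Tendsto (fun i => rightInv (U i)) atTop (𝓝 (rightInv W)) :=
    (continuousAt_rightInv hW).tendsto.comp hU
  have hmodel : Continuous fun p : ℝ × Matrix (Fin B) (Fin (M + 1)) ℂ ×
      Matrix (Fin (M + 1)) (Fin B) ℂ =>
        p.1 * ‖p.2.2‖ ^ 2 - 2 * (p.2.1 * p.2.1ᴴ * p.2.1 * p.2.2).trace.re := by
    have h1 : Continuous fun p : ℝ × Matrix (Fin B) (Fin (M + 1)) ℂ ×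
      Matrix (Fin (M + 1)) (Fin B) ℂ => ‖p.2.2‖ := continuous_frobenius_norm.comp (by fun_prop)
    have h2 : Continuous fun p : ℝ × Matrix (Fin B) (Fin (M + 1)) ℂ ×
      Matrix (Fin (M + 1)) (Fin B) ℂ => (p.2.1 * p.2.1ᴴ * p.2.1 * p.2.2).trace :=
        Continuous.matrix_trace (by fun_prop)
    fun_prop
  have hlim : ∀ (C : ℕ → Matrix (Fin (M + 1)) (Fin B) ℂ) (C₀ : Matrix (Fin (M + 1)) (Fin B) ℂ),
      Tendsto C atTop (𝓝 C₀) → Tendsto (fun i => lam (U i) * ‖C i - U i‖ ^ 2 -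
        2 * (rightInv (U i) * (rightInv (U i))ᴴ * rightInv (U i) * (C i - U i)).trace.re) atTop
        (𝓝 (lam W * ‖C₀ - W‖ ^ 2 -
          2 * (rightInv W * (rightInv W)ᴴ * rightInv W * (C₀ - W)).trace.re)) :=
    fun C C₀ hC => (hmodel.tendsto (lam W, rightInv W, C₀ - W)).comp
      (hlam.prodMk_nhds (hX.prodMk_nhds (hC.sub hU)))
  refine isStationary_of_quadratic_model (c := lam W) hfeas hW fun C hC => ?_
  have h := le_of_tendsto_of_tendsto' (hlim U' W hU') (hlim (fun _ => C) C tendsto_const_nhds)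
    fun i => (hupd i).quadratic_model_le (hreg i) hC
  simpa using h

end Convergence

end RISPattern

end

theorem theorem2 (M B : ℕ) (hB : M + 1 ≤ B) (βmin δ α : ℝ)
    (hβ0 : 0 ≤ βmin) (hβ1 : βmin ≤ 1) (hδ : 0 ≤ δ) (hα : 0 ≤ α)
    (Vinit : Matrix (Fin (M + 1)) (Fin B) ℂ)
    (hfeas : Vinit ∈ RISPattern.feasible M B βmin δ α)
    (hreg : RISPattern.Regular Vinit) :
    (∃ V : ℕ → Matrix (Fin (M + 1)) (Fin B) ℂ, RISPattern.IsRun βmin δ α Vinit V) ∧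
    ∀ V : ℕ → Matrix (Fin (M + 1)) (Fin B) ℂ, RISPattern.IsRun βmin δ α Vinit V →
      (∀ i, V i ∈ RISPattern.feasible M B βmin δ α ∧ RISPattern.Regular (V i)) ∧
      Antitone (fun i => RISPattern.objective (V i)) ∧
      Tendsto (fun i => ‖V (i + 1) - V i‖) atTop (𝓝 0) ∧
      ∃ J : ℝ, Tendsto (fun i => RISPattern.objective (V i)) atTop (𝓝 J) ∧
        (∃ W, MapClusterPt W atTop V) ∧
        (∀ W, MapClusterPt W atTop V →
          RISPattern.IsStationary βmin δ α W ∧ RISPattern.objective W = J) ∧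
        Tendsto (fun i => Metric.infDist (V i)
          {W | RISPattern.IsStationary βmin δ α W ∧ RISPattern.objective W = J})
          atTop (𝓝 0) ∧
        (∀ W, MapClusterPt W atTop V →
          (∀ᶠ W' in 𝓝 W, RISPattern.IsStationary βmin δ α W' →
            RISPattern.objective W' = J → W' = W) →
          Tendsto V atTop (𝓝 W)) := by
  have : FirstCountableTopology (Matrix (Fin (M + 1)) (Fin B) ℂ) :=
    inferInstanceAs (FirstCountableTopology (Fin (M + 1) → Fin B → ℂ))
  refine ⟨RISPattern.exists_isRun hα Vinit, fun V hV => ?_⟩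
  have hmem := hV.mem_feasible_and_regular hfeas hreg
  have hdec : ∀ i, RISPattern.objective (V (i + 1)) ≤
      RISPattern.objective (V i) - (B : ℝ)⁻¹ ^ 2 * ‖V (i + 1) - V i‖ ^ 2 := fun i =>
    ((hV.2 i).sufficient_decrease (hmem i).2 (hmem i).1).2
  have hanti : Antitone fun i => RISPattern.objective (V i) :=
    antitone_nat_of_succ_le fun i => (hdec i).trans (sub_le_self _ (by positivity))
  -- Makes the decrease constant `B⁻¹ ^ 2` positive.
  have hB0 : (0 : ℝ) < B := by exact_mod_cast Nat.lt_of_lt_of_le M.succ_pos hB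
  have hJ : Tendsto (fun i => RISPattern.objective (V i)) atTop
      (𝓝 (⨅ i, RISPattern.objective (V i))) := by
    refine tendsto_atTop_ciInf hanti ⟨0, ?_⟩
    rintro _ ⟨i, rfl⟩
    change 0 ≤ RISPattern.objective (V i)
    rw [RISPattern.objective_eq_norm_rightInv_sq (hmem i).2]
    positivity
  have hstep : Tendsto (fun i => ‖V (i + 1) - V i‖) atTop (𝓝 0) :=
    RISPattern.tendsto_zero_of_sufficient_decrease (by positivity) (fun _ => norm_nonneg _) hdec hJ
  have hK := RISPattern.isCompact_sublevel (M := M) (B := B) (βmin := βmin) (δ := δ) hα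
    (RISPattern.objective Vinit)
  have hVK : ∀ i, V i ∈ {V | V ∈ RISPattern.feasible M B βmin δ α ∧ RISPattern.Regular V ∧
      RISPattern.objective V ≤ RISPattern.objective Vinit} := fun i =>
    ⟨(hmem i).1, (hmem i).2, by rw [← hV.1]; exact hanti (Nat.zero_le i)⟩
  have hcluster : ∀ W, MapClusterPt W atTop V → RISPattern.IsStationary βmin δ α W ∧
      RISPattern.objective W = ⨅ i, RISPattern.objective (V i) := by
    intro W hW
    obtain ⟨hWf, hWr, -⟩ := hK.isClosed.mem_of_mapClusterPt hW (Eventually.of_forall hVK)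
    obtain ⟨φ, hφ, hlim⟩ := hW.tendsto_subseq
    -- Vanishing steps give the shifted subsequence the same limit, so `W` is a limit of updates of
    -- points tending to `W`.
    have hlim' : Tendsto (fun i => V (φ i + 1)) atTop (𝓝 W) := by
      have h0 : Tendsto (fun i => V (φ i + 1) - V (φ i)) atTop (𝓝 0) :=
        tendsto_zero_iff_norm_tendsto_zero.2 (hstep.comp hφ.tendsto_atTop)
      simpa using h0.add hlim
    exact ⟨RISPattern.isStationary_of_tendsto hWf hWr (fun i => (hmem (φ i)).2)
        (fun i => hV.2 (φ i)) hlim hlim',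
      tendsto_nhds_unique ((RISPattern.continuousAt_objective hWr).tendsto.comp hlim)
        (hJ.comp hφ.tendsto_atTop)⟩
  refine ⟨hmem, hanti, hstep, _, hJ, ?_, hcluster, ?_, fun W hW hiso => ?_⟩
  · obtain ⟨W, -, φ, hφ, hlim⟩ := hK.tendsto_subseq hVK
    exact ⟨W, MapClusterPt.of_comp hφ.tendsto_atTop hlim.mapClusterPt⟩
  · exact RISPattern.tendsto_infDist_of_mapClusterPt_mem hK hVK hcluster
  · refine RISPattern.tendsto_of_isolated_mapClusterPt hK hVK ?_ hW ?_
    · simpa only [dist_eq_norm] using hstep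
    -- All cluster points are stationary with value `J`, so isolation among the latter implies
    -- isolation among cluster points.
    · exact hiso.mono fun W' h hW' => h (hcluster W' hW').1 (hcluster W' hW').2
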